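/- Let $H$ be a function that assigns to every $n\in\omega$ a finite set $H(n)\subseteq\omega$ with $|H(n)|\ge 2$. Let $\mathrm{PT}_H$ be the set of all nonempty subtrees $p\subseteq\omega^{<\omega}$ (nonempty sets of finite sequences closed under initial segments) such that, with $\mathrm{succ}_p(\eta)=\{k\in\omega:\eta^\frown k\in p\}$, 1. for all $\eta\in p$ and $l<|\eta|$ we have $\eta(l)\in H(l)$; 2. for all $\eta\in p$ we have $|\mathrm{succ}_p(\eta)|\in\{1,|H(|\eta|)|\}$; 3. for every $\eta\in p$ there is $\nu\in p$ with $\eta\subseteq\nu$ and $|\mathrm{succ}_p(\nu)|=|H(|\nu|)|$. Order $\mathrm{PT}_H$ by inclusion: $p_1\le p_0$ ($p_1$ is stronger) if and only if $p_1\subseteq p_0$. Then the forcing notion $\mathbb P=\mathrm{PT}_H$ has property $(\dagger)$, that is: for all sufficiently large cardinals $\theta$, for every countable elementary submodel $M$ of $H(\theta)$ (the collection of sets whose transitive closure has cardinality less than $\theta$, with the membership relation) with $\mathbb P\in M$, every condition $p\in\mathbb P\cap M$, and every sequence of functions $\varphi_i:\mathbb P\cap M\to\mathbb P\cap M$ ($i\in\omega$)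 such that $\varphi_i(r)\le r$ for all $r\in\mathbb P\cap M$ and $i\in\omega$, there is an $(M,\mathbb P)$-generic condition $q\le p$ such that $$q\Vdash\text{``}\Gamma_{\mathbb P}\cap\{\varphi_i(r):r\in\mathbb P\cap M\}\text{ is infinite for all }i\in\omega\text{''},$$ where $\Gamma_{\mathbb P}$ is the canonical name of the generic filter. Here $q$ is $(M,\mathbb P)$-generic if $q\Vdash\Gamma_{\mathbb P}\cap D\cap M\neq\emptyset$ for every dense set $D\subseteq\mathbb P$ with $D\in M$. -/

import Mathlib

universe u

noncomputable section

/-! ### Elementary submodels of `H(θ)` -/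

/-- The non-logical symbols of the language of set theory: one binary relation symbol. -/
inductive MemSymbol : ℕ → Type
  | mem : MemSymbol 2

/-- The first-order language `{∈}` of set theory. -/
def memLanguage : FirstOrder.Language.{0, 0} where
  Functions := fun _ => Empty
  Relations := MemSymbol

/-- `H(θ)`, the collection of all sets whose transitive closure has cardinality less than `θ`
(equivalently, that are included in some transitive set of cardinality less than `θ`). -/
def HSet (θ : Cardinal.{u}) : Set ZFSet.{u} :=
  {x | ∃ y : ZFSet.{u}, y.IsTransitive ∧ x ⊆ y ∧ y.card < θ}

/-- `H(θ)` with the true membership relation, as a structure for the language of set theory. -/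
instance HSet.memStructure (θ : Cardinal.{u}) : memLanguage.Structure (HSet θ) where
  funMap := fun f _ => f.elim
  RelMap := fun r => match r with
    | MemSymbol.mem => fun v => (v 0 : ZFSet.{u}) ∈ (v 1 : ZFSet.{u})

/-- Elementary submodels of `H(θ)`. -/
abbrev ElemSubmodel (θ : Cardinal.{u}) := memLanguage.ElementarySubstructure (HSet θ)

/-- The collection of the sets that belong to the elementary submodel `M`. -/
def ElemSubmodel.sets {θ : Cardinal.{u}} (M : ElemSubmodel θ) : Set ZFSet.{u} :=
  {x | ∃ h : x ∈ HSet θ, (⟨x, h⟩ : HSet θ) ∈ M}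

/-! ### Forcing notions -/

/-- A forcing notion: a partially ordered set, given as a set-theoretic object. Here
`(r, p) ∈ rel` means `r ≤ p`, i.e. that `r` is stronger than `p`. -/
structure ForcingPoset where
  /-- the set of conditions -/
  carrier : ZFSet.{u}
  /-- the order, as a set of ordered pairs of conditions -/
  rel : ZFSet.{u}
  rel_subset : rel ⊆ carrier.prod carrier
  rel_refl : ∀ p ∈ carrier, ZFSet.pair p p ∈ rel
  rel_trans : ∀ p q r, ZFSet.pair p q ∈ rel → ZFSet.pair q r ∈ rel → ZFSet.pair p r ∈ rel
  rel_antisymm : ∀ p q, ZFSet.pair p q ∈ rel → ZFSet.pair q p ∈ rel → p = q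

namespace ForcingPoset

variable (P : ForcingPoset.{u})

/-- The forcing notion as a single set, the ordered pair of its carrier and its order. -/
def code : ZFSet.{u} := ZFSet.pair P.carrier P.rel

/-- The type of conditions. -/
@[ext]
structure Cond where
  /-- the condition, as a set -/
  val : ZFSet.{u}
  mem_carrier : val ∈ P.carrier

instance : PartialOrder P.Cond where
  le r p := ZFSet.pair r.val p.val ∈ P.rel
  le_refl p := P.rel_refl p.val p.mem_carrier
  le_trans p q r := P.rel_trans p.val q.val r.val
  le_antisymm p q h h' := Cond.ext (P.rel_antisymm p.val q.val h h')

/-- The conditions that belong to the elementary submodel `M`, i.e. `P ∩ M`. -/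
abbrev CondIn {θ : Cardinal.{u}} (M : ElemSubmodel θ) : Type (u + 1) :=
  {p : P.Cond // p.val ∈ M.sets}

/-! #### The forcing relation

The assertions about the generic filter `Γ` used below are built from the atomic ones `a ∈ Γ`,
for a condition `a`, by quantification over collections `ι` of the ground model. An assertion is
represented by the property of being a condition that forces it, and the
constructors are the usual recursive clauses of the forcing relation. -/

/-- Assertions of the forcing language, identified with the property of forcing them. -/
abbrev Assertion : Type (u + 1) := P.Cond → Prop

variable {P}

/-- `q ⊩ ψ`. -/
def Forces (q : P.Cond) (ψ : P.Assertion) : Prop := ψ q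

/-- The assertion `a ∈ Γ`, where `Γ` is the canonical name of the generic filter: it is forced by
`q` if and only if the conditions stronger than `a` are dense below `q`. -/
def memGeneric (a : P.Cond) : P.Assertion := fun q => ∀ r ≤ q, ∃ s ≤ r, s ≤ a

/-- The assertion `∀ i ∈ ι, ψ i`: it is forced by `q` if and only if `q` forces every `ψ i`. -/
def forallGround {ι : Sort*} (ψ : ι → P.Assertion) : P.Assertion :=
  fun q => ∀ i, Forces q (ψ i)

/-- The assertion `∃ i ∈ ι, ψ i`: it is forced by `q` if and only if the conditions that force
`ψ i` for some `i` are dense below `q`. -/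
def existsGround {ι : Sort*} (ψ : ι → P.Assertion) : P.Assertion :=
  fun q => ∀ r ≤ q, ∃ s ≤ r, ∃ i, Forces s (ψ i)

/-- The assertion `Γ ∩ A ≠ ∅`, for a set `A` of conditions. -/
def genericMeets (A : Set P.Cond) : P.Assertion :=
  existsGround fun a : A => memGeneric a.1

/-- The assertion `Γ ∩ A is infinite`, for a set `A` of conditions: for every natural number `n`
there are `n` pairwise distinct elements of `A` that belong to `Γ`. -/
def genericMeetsInfinite (A : Set P.Cond) : P.Assertion :=
  forallGround fun n : ℕ => existsGround fun s : Fin n ↪ A =>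
    forallGround fun k : Fin n => memGeneric (s k).1

/-- The set `D` is a dense subset of `P`. -/
def IsDenseSubset (P : ForcingPoset.{u}) (D : ZFSet.{u}) : Prop :=
  D ⊆ P.carrier ∧ ∀ p : P.Cond, ∃ d : P.Cond, d ≤ p ∧ d.val ∈ D

/-- `q` is an `(M, P)`-generic condition: `q` forces `Γ ∩ D ∩ M ≠ ∅` for every dense subset `D`
of `P` that belongs to `M`. -/
def IsGenericCond {θ : Cardinal.{u}} (M : ElemSubmodel θ) (q : P.Cond) : Prop :=
  ∀ D ∈ M.sets, P.IsDenseSubset D → Forces q (genericMeets {d | d.val ∈ D ∧ d.val ∈ M.sets})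

/-- The property `(†)` of a forcing notion `P`: for all sufficiently large `θ`, every countable
elementary submodel `M` of `H(θ)` with `P ∈ M`, every `p ∈ P ∩ M` and all regressive functions
`φ i : P ∩ M → P ∩ M` (`i ∈ ω`), there is an `(M, P)`-generic condition `q ≤ p` that forces
"for all `i`, the set `Γ ∩ {φ i r : r ∈ P ∩ M}` is infinite". -/
def Dagger (P : ForcingPoset.{u}) : Prop :=
  ∃ θ₀ : Cardinal.{u}, ∀ θ ≥ θ₀, ∀ M : ElemSubmodel θ, Countable M → P.code ∈ M.sets →
    ∀ (p : P.CondIn M) (φ : ℕ → P.CondIn M → P.CondIn M), (∀ i r, (φ i r).1 ≤ r.1) →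
      ∃ q : P.Cond, q ≤ p.1 ∧ IsGenericCond M q ∧
        Forces q (forallGround fun i : ℕ =>
          genericMeetsInfinite {a | ∃ r : P.CondIn M, (φ i r).1 = a})

end ForcingPoset

/-! ### The forcing `PT_H` -/

namespace PT

/-- The set `{k : η⌢k ∈ p}` of immediate successors of `η` in the tree `p`. -/
def succ (p : Set (List ℕ)) (η : List ℕ) : Set ℕ := {k | η ++ [k] ∈ p}

/-- `p` is a (nonempty) subtree of `ω^{<ω}` that belongs to `PT_H`. Finite sequences of natural
numbers are represented by lists; `η <+: ν` says that `ν` extends `η`. -/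
structure IsCond (H : ℕ → Finset ℕ) (p : Set (List ℕ)) : Prop where
  nonempty : p.Nonempty
  prefix_closed : ∀ ν ∈ p, ∀ η, η <+: ν → η ∈ p
  mem_H : ∀ η ∈ p, ∀ (l : ℕ) (hl : l < η.length), η[l] ∈ H l
  succ_card : ∀ η ∈ p,
    (succ p η).ncard = 1 ∨ (succ p η).ncard = (H η.length).card
  exists_split : ∀ η ∈ p, ∃ ν ∈ p,
    η <+: ν ∧ (succ p ν).ncard = (H ν.length).card

/-- The natural number `n` as a von Neumann ordinal. -/
def natCode : ℕ → ZFSet.{u}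
  | 0 => ∅
  | n + 1 => insert (natCode n) (natCode n)

/-- The finite sequence `η` as a set-theoretic function, `{(i, η i) : i < |η|}`. -/
def seqCode (η : List ℕ) : ZFSet.{u} :=
  ZFSet.range fun i : Fin η.length => ZFSet.pair (natCode i) (natCode (η.get i))

/-- A set of finite sequences of natural numbers, as a set. -/
def treeCode (p : Set (List ℕ)) : ZFSet.{u} :=
  ZFSet.range fun η : p => seqCode η.1

/-- The set of conditions of `PT_H`. -/
def carrier (H : ℕ → Finset ℕ) : ZFSet.{u} :=
  ZFSet.range fun p : {p : Set (List ℕ) // IsCond H p} => treeCode p.1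

/-- The forcing notion `PT_H`, ordered by inclusion. -/
def forcing (H : ℕ → Finset ℕ) : ForcingPoset.{u} where
  carrier := carrier H
  rel := ZFSet.pairSep (fun q p => q ⊆ p) (carrier H) (carrier H)
  rel_subset := by
    intro z hz
    obtain ⟨a, ha, b, hb, rfl, -⟩ := ZFSet.mem_pairSep.1 hz
    exact ZFSet.pair_mem_prod.2 ⟨ha, hb⟩
  rel_refl := fun p hp => ZFSet.mem_pairSep.2 ⟨p, hp, p, hp, rfl, fun _ h => h⟩
  rel_trans := by
    intro p q r hpq hqr
    obtain ⟨a, ha, b, hb, hab, h⟩ := ZFSet.mem_pairSep.1 hpq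
    obtain ⟨b', hb', c, hc, hbc, h'⟩ := ZFSet.mem_pairSep.1 hqr
    obtain ⟨rfl, rfl⟩ := ZFSet.pair_inj.1 hab
    obtain ⟨rfl, rfl⟩ := ZFSet.pair_inj.1 hbc
    exact ZFSet.mem_pairSep.2 ⟨_, ha, _, hc, rfl, fun _ hx => h' (h hx)⟩
  rel_antisymm := by
    intro p q hpq hqp
    obtain ⟨a, -, b, -, hab, h⟩ := ZFSet.mem_pairSep.1 hpq
    obtain ⟨b', -, a', -, hba, h'⟩ := ZFSet.mem_pairSep.1 hqp
    obtain ⟨rfl, rfl⟩ := ZFSet.pair_inj.1 hab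
    obtain ⟨rfl, rfl⟩ := ZFSet.pair_inj.1 hba
    exact ZFSet.ext fun x => ⟨fun hx => h hx, fun hx => h' hx⟩

end PT

end

/-!
The condition `q` is obtained by fusion. Let `f` enumerate the members of `M`. To each node `η` of
the `n`-th level of a finitely branching scheme a condition `r ∈ M` is attached, all of whose nodes
are comparable with `η`; the root carries `p`. Given `(η, r)`, let `d ≤ r` be a condition in `M`
that belongs to `f n` if `f n` is dense, and shrink it further to `t = φ i d`, where `n` codes the
pair `(i, k)`. Choose a splitting node `ν` of `t` above `η`; the nodes of the next level above `η`
are the immediate successors `ν⌢j` of `ν`, with the full subtrees of `t` at `ν⌢j` attached. The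
tree `q` of all initial segments of nodes of the scheme is again in `PT_H`, since it splits fully at
the chosen nodes `ν` and nowhere else (`PT.IsFusionData.isCond_fusion`). Above a node of the scheme
`q` is included in the attached condition, so every `q' ⊆ q` can be shrunk to a condition below one
`φ i d` of every level less than a given `n`. These `φ i d` decrease strictly, since each
choice of a successor `ν⌢j` discards the other ones; this is where `2 ≤ |H n|` is used
(`PT.exists_fusion`). Genericity follows as `φ i d ≤ d`, and infinity as every `i` is
treated at infinitely many levels.

The only closure properties of `M` needed are that the full subtree of a condition in `M` at any
node is in `M` (`PT.treeCode_restrict_mem_sets`), and that a dense set in `M` has an element in `M`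
below every condition in `M` (`PT.exists_condIn_le`). Both come from elementarity in `H(θ)` for
formulas in which all quantifiers are bounded, so they are evaluated correctly in the
transitive set `H(θ)`; any infinite `θ` will do. The scheme itself need not belong to `M`.
-/

noncomputable section

/-! ### Full subtrees of conditions -/

namespace PT

variable {H : ℕ → Finset ℕ} {p q r : Set (List ℕ)} {η ν x y : List ℕ}

/-- The full subtree of `p` at `η`: the nodes of `p` that are comparable with `η`. -/
def restrict (p : Set (List ℕ)) (η : List ℕ) : Set (List ℕ) :=
  {x | x ∈ p ∧ (x <+: η ∨ η <+: x)}

theorem restrict_subset : restrict p η ⊆ p := fun _ hx => hx.1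

theorem mem_restrict_self (hη : η ∈ p) : η ∈ restrict p η := ⟨hη, Or.inl (List.prefix_refl η)⟩

namespace IsCond

theorem succ_subset (hp : IsCond H p) (η : List ℕ) : succ p η ⊆ H η.length := by
  intro k hk
  simpa using hp.mem_H (η ++ [k]) hk η.length (by simp)

theorem succ_eq_of_splits (hp : IsCond H p) (h : (succ p η).ncard = (H η.length).card) :
    succ p η = H η.length :=
  Set.eq_of_subset_of_ncard_le (hp.succ_subset η) (by rw [h, Set.ncard_coe_finset])
    (Finset.finite_toSet _)

theorem nil_mem (hp : IsCond H p) : [] ∈ p := by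
  obtain ⟨x, hx⟩ := hp.nonempty
  exact hp.prefix_closed x hx [] List.nil_prefix

theorem restrict (hp : IsCond H p) (hη : η ∈ p) : IsCond H (restrict p η) where
  nonempty := ⟨η, mem_restrict_self hη⟩
  prefix_closed := by
    rintro ν ⟨hν, h | h⟩ x hx
    · exact ⟨hp.prefix_closed ν hν x hx, Or.inl (hx.trans h)⟩
    · exact ⟨hp.prefix_closed ν hν x hx, List.prefix_or_prefix_of_prefix hx h⟩
  mem_H := fun x hx => hp.mem_H x hx.1
  succ_card := by
    rintro x ⟨hx, h⟩
    by_cases hηx : η <+: x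
    · have : succ (PT.restrict p η) x = succ p x := by
        ext k
        exact ⟨fun h => h.1, fun h => ⟨h, Or.inr (hηx.trans (List.prefix_append _ _))⟩⟩
      rw [this]
      exact hp.succ_card x hx
    · obtain ⟨t, rfl⟩ := h.resolve_right hηx
      cases t with
      | nil => simp at hηx
      | cons k t =>
        left
        rw [Set.ncard_eq_one]
        refine ⟨k, Set.ext fun j => ⟨?_, ?_⟩⟩
        · rintro ⟨-, h | h⟩
          · simpa [List.prefix_append_right_inj] using h
          · simp only [List.prefix_append_right_inj] at h
            simp only [List.cons_prefix_cons] at h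
            exact h.1.symm
        · rintro rfl
          have : x ++ [j] <+: x ++ j :: t := by simp [List.prefix_append_right_inj]
          exact ⟨hp.prefix_closed _ hη _ this, Or.inl this⟩
  exists_split := by
    rintro x ⟨hx, h⟩
    have key : ∀ y ∈ p, η <+: y → x <+: y → ∃ ν ∈ PT.restrict p η, x <+: ν ∧
        (succ (PT.restrict p η) ν).ncard = (H ν.length).card := by
      intro y hy hηy hxy
      obtain ⟨ν, hν, hyν, hs⟩ := hp.exists_split y hy
      refine ⟨ν, ⟨hν, Or.inr (hηy.trans hyν)⟩, hxy.trans hyν, ?_⟩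
      rw [← hs]
      congr 1
      ext k
      exact ⟨fun h => h.1,
        fun h => ⟨h, Or.inr ((hηy.trans hyν).trans (List.prefix_append _ _))⟩⟩
    rcases h with h | h
    · exact key η hη (List.prefix_refl η) h
    · exact key x hx h (List.prefix_refl x)

/-- A condition has nodes of arbitrary length, because `H n` is never empty. -/
theorem exists_long (hp : IsCond H p) (hH : ∀ n, 2 ≤ (H n).card) (n : ℕ) :
    ∃ η ∈ p, n ≤ η.length := by
  induction n with
  | zero => exact ⟨[], hp.nil_mem, Nat.zero_le _⟩
  | succ n ih =>
    obtain ⟨η, hη, hn⟩ := ih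
    have : (succ p η).ncard ≠ 0 := by
      have := hH η.length
      rcases hp.succ_card η hη with h | h <;> omega
    obtain ⟨k, hk⟩ := Set.nonempty_of_ncard_ne_zero this
    exact ⟨η ++ [k], hk, by simpa using hn⟩

end IsCond

/-! ### The fusion of a scheme of conditions -/

section Fusion

variable (H) (ψ : ℕ → Set (List ℕ) → Set (List ℕ)) (σ : Set (List ℕ) → List ℕ → List ℕ)
  (p : Set (List ℕ))

/-- The fusion scheme with root `p`. `Reach n η r` says that `η` is a node of level `n` of the
scheme, to which the condition `r` is attached. Above it, `r` is shrunk to `ψ n r`, the splitting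
node `σ (ψ n r) η` is kept, and every immediate successor of it becomes a node of level `n + 1`. -/
inductive Reach : ℕ → List ℕ → Set (List ℕ) → Prop
  | zero : Reach 0 [] p
  | succ {n : ℕ} {η : List ℕ} {r : Set (List ℕ)} (h : Reach n η r) {k : ℕ}
      (hk : k ∈ H (σ (ψ n r) η).length) :
      Reach (n + 1) (σ (ψ n r) η ++ [k]) (restrict (ψ n r) (σ (ψ n r) η ++ [k]))

/-- The tree spanned by the nodes of the fusion scheme. -/
def fusion : Set (List ℕ) := {x | ∃ n η r, Reach H ψ σ p n η r ∧ x <+: η}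

variable {ψ σ p} {C : Set (Set (List ℕ))} {n m : ℕ} {r' : Set (List ℕ)}

/-- The requirements on the data of a fusion scheme: `C` is a collection of conditions that is
closed under full subtrees at nodes and under the shrinking operations `ψ n`, and `σ r η` is a
splitting node of `r` above `η`. -/
structure IsFusionData (C : Set (Set (List ℕ))) (ψ : ℕ → Set (List ℕ) → Set (List ℕ))
    (σ : Set (List ℕ) → List ℕ → List ℕ) : Prop where
  isCond : ∀ r ∈ C, IsCond H r
  restrict_mem : ∀ r ∈ C, ∀ η ∈ r, restrict r η ∈ C
  shrink_mem : ∀ n, ∀ r ∈ C, ψ n r ∈ C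
  shrink_subset : ∀ n, ∀ r ∈ C, ψ n r ⊆ r
  prefix_split : ∀ r ∈ C, ∀ η ∈ r, η <+: σ r η
  succ_split : ∀ r ∈ C, ∀ η ∈ r, succ r (σ r η) = H (σ r η).length

variable {H}

namespace IsFusionData

/-- A condition all of whose nodes are comparable with `η` contains `η`, because it has nodes of
every length. -/
theorem mem_of_subset_of_comparable {s : Set (List ℕ)} (hs : IsCond H s)
    (hH : ∀ n, 2 ≤ (H n).card) (h : ∀ x ∈ s, x <+: η ∨ η <+: x) : η ∈ s := by
  obtain ⟨x, hx, hl⟩ := hs.exists_long hH η.length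
  rcases h x hx with h | h
  · exact h.eq_of_length_le hl ▸ hx
  · exact hs.prefix_closed x hx η h

variable (hF : IsFusionData H C ψ σ) (hH : ∀ n, 2 ≤ (H n).card) (hp : p ∈ C)
include hF hH hp

theorem reach_spec (h : Reach H ψ σ p n η r) :
    r ∈ C ∧ n ≤ η.length ∧ (∀ x ∈ r, x <+: η ∨ η <+: x) := by
  induction h with
  | zero => exact ⟨hp, le_rfl, fun x _ => Or.inr List.nil_prefix⟩
  | @succ n η r h k hk ih =>
    obtain ⟨hr, hn, hc⟩ := ih
    have hψ := hF.shrink_mem n r hr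
    have hη : η ∈ ψ n r := mem_of_subset_of_comparable (hF.isCond _ hψ) hH
      fun x hx => hc x (hF.shrink_subset n r hr hx)
    refine ⟨hF.restrict_mem _ hψ _ ?_, ?_, fun x hx => hx.2⟩
    · rw [← Finset.mem_coe, ← hF.succ_split _ hψ _ hη] at hk
      exact hk
    · have := (hF.prefix_split _ hψ _ hη).length_le
      simp
      omega

theorem mem_of_reach (h : Reach H ψ σ p n η r) : η ∈ r :=
  have h' := hF.reach_spec hH hp h
  mem_of_subset_of_comparable (hF.isCond _ h'.1) hH h'.2.2

theorem mem_shrink_of_reach (h : Reach H ψ σ p n η r) : η ∈ ψ n r :=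
  have h' := hF.reach_spec hH hp h
  mem_of_subset_of_comparable (hF.isCond _ (hF.shrink_mem n r h'.1)) hH
    fun x hx => h'.2.2 x (hF.shrink_subset n r h'.1 hx)

theorem prefix_split_of_reach (h : Reach H ψ σ p n η r) : η <+: σ (ψ n r) η :=
  hF.prefix_split _ (hF.shrink_mem n r (hF.reach_spec hH hp h).1) _
    (hF.mem_shrink_of_reach hH hp h)

/-- Nodes of the same level of the fusion scheme are incomparable. -/
theorem reach_unique (h : Reach H ψ σ p n η r) (h' : Reach H ψ σ p n ν r') (hη : η <+: x)
    (hν : ν <+: x) : η = ν ∧ r = r' := by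
  induction h generalizing ν r' with
  | zero =>
    cases h'
    exact ⟨rfl, rfl⟩
  | @succ n η r h k hk ih =>
    cases h' with
    | @succ _ η' r₁ h' k' hk' =>
      have e := fun y : List ℕ => fun j : ℕ => List.prefix_append y [j]
      obtain ⟨rfl, rfl⟩ := ih h'
        ((hF.prefix_split_of_reach hH hp h).trans ((e _ _).trans hη))
        ((hF.prefix_split_of_reach hH hp h').trans ((e _ _).trans hν))
      have : σ (ψ n r) η ++ [k] = σ (ψ n r) η ++ [k'] :=
        (List.prefix_of_prefix_length_le hη hν (by simp)).eq_of_length (by simp)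
      rw [← this]
      exact ⟨rfl, rfl⟩

theorem exists_reach_succ (h : Reach H ψ σ p n η r) :
    ∃ ν s, Reach H ψ σ p (n + 1) ν s ∧ η <+: ν := by
  obtain ⟨k, hk⟩ : (H (σ (ψ n r) η).length).Nonempty :=
    Finset.card_pos.1 (by have := hH (σ (ψ n r) η).length; omega)
  exact ⟨_, _, .succ h hk,
    (hF.prefix_split_of_reach hH hp h).trans (List.prefix_append _ _)⟩

theorem exists_reach_add (h : Reach H ψ σ p n η r) (m : ℕ) :
    ∃ ν s, Reach H ψ σ p (n + m) ν s ∧ η <+: ν := by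
  induction m with
  | zero => exact ⟨η, r, h, List.prefix_refl η⟩
  | succ m ih =>
    obtain ⟨ν, s, hν, hην⟩ := ih
    obtain ⟨ν', s', hν', hνν'⟩ := hF.exists_reach_succ hH hp hν
    exact ⟨ν', s', hν', hην.trans hνν'⟩

theorem exists_reach_ancestor (h : Reach H ψ σ p n η r) (hm : m ≤ n) :
    ∃ ν s, Reach H ψ σ p m ν s ∧ ν <+: η ∧ r ⊆ s := by
  induction h with
  | zero =>
    obtain rfl : m = 0 := by omega
    exact ⟨_, _, .zero, List.prefix_refl _, subset_rfl⟩
  | @succ n η r h k hk ih =>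
    rcases hm.lt_or_eq with hm | rfl
    · obtain ⟨ν, s, hν, hνη, hs⟩ := ih (by omega)
      refine ⟨ν, s, hν, hνη.trans ((hF.prefix_split_of_reach hH hp h).trans
        (List.prefix_append _ _)), ?_⟩
      exact (restrict_subset.trans (hF.shrink_subset n r (hF.reach_spec hH hp h).1)).trans hs
    · exact ⟨_, _, .succ h hk, List.prefix_refl _, subset_rfl⟩

/-- Every node of the fusion lies below scheme nodes of arbitrarily high level. -/
theorem exists_reach_of_mem_fusion (hx : x ∈ fusion H ψ σ p) (m : ℕ) :
    ∃ n η r, m ≤ n ∧ Reach H ψ σ p n η r ∧ x <+: η := by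
  obtain ⟨n, η, r, h, hxη⟩ := hx
  obtain ⟨ν, s, hν, hην⟩ := hF.exists_reach_add hH hp h m
  exact ⟨n + m, ν, s, by omega, hν, hxη.trans hην⟩

/-- Above a node `η` of the scheme, the fusion is contained in the attached condition. -/
theorem mem_of_mem_fusion (hx : x ∈ fusion H ψ σ p) (h : Reach H ψ σ p m η r) (hηx : η <+: x) :
    x ∈ r := by
  obtain ⟨n, ν, s, hmn, hν, hxν⟩ := hF.exists_reach_of_mem_fusion hH hp hx m
  obtain ⟨η', r', h', hη'ν, hs⟩ := hF.exists_reach_ancestor hH hp hν hmn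
  obtain ⟨rfl, rfl⟩ := hF.reach_unique hH hp h h' (hηx.trans hxν) hη'ν
  exact (hF.isCond _ (hF.reach_spec hH hp h).1).prefix_closed ν
    (hs (hF.mem_of_reach hH hp hν)) x hxν

theorem fusion_subset : fusion H ψ σ p ⊆ p :=
  fun _ hx => hF.mem_of_mem_fusion hH hp hx .zero List.nil_prefix

omit hF hH hp in
theorem mem_fusion_of_prefix (hy : y ∈ fusion H ψ σ p) (h : x <+: y) : x ∈ fusion H ψ σ p := by
  obtain ⟨n, η, r, hr, hyη⟩ := hy
  exact ⟨n, η, r, hr, h.trans hyη⟩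

/-- Every node of the fusion lies between a node of the scheme and the splitting node kept
above it. -/
theorem exists_reach_between (hx : x ∈ fusion H ψ σ p) :
    ∃ n η r, Reach H ψ σ p n η r ∧ η <+: x ∧ x <+: σ (ψ n r) η := by
  obtain ⟨n, η, r, h, hxη⟩ := hx
  induction h with
  | zero =>
    obtain rfl := List.prefix_nil.1 hxη
    exact ⟨0, _, _, .zero, List.prefix_refl _, List.nil_prefix⟩
  | @succ n η r h k hk ih =>
    rcases List.prefix_concat_iff.1 hxη with rfl | hxν
    · exact ⟨_, _, _, .succ h hk, List.prefix_refl _,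
        hF.prefix_split_of_reach hH hp (.succ h hk)⟩
    · rcases List.prefix_or_prefix_of_prefix hxν (hF.prefix_split_of_reach hH hp h) with h' | h'
      · exact ih h'
      · exact ⟨_, _, _, h, h', hxν⟩

/-- A node of the fusion above a scheme node `η` is comparable with one of the immediate
successors of the splitting node kept above `η`. -/
theorem exists_comparable (hy : y ∈ fusion H ψ σ p) (h : Reach H ψ σ p n η r) (hη : η <+: y) :
    ∃ k ∈ H (σ (ψ n r) η).length, y <+: σ (ψ n r) η ++ [k] ∨ σ (ψ n r) η ++ [k] <+: y := by
  obtain ⟨m, ν, s, hnm, hν, hyν⟩ := hF.exists_reach_of_mem_fusion hH hp hy (n + 1)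
  obtain ⟨η', r', h', hη'ν, -⟩ := hF.exists_reach_ancestor hH hp hν hnm
  cases h' with
  | @succ _ η₀ r₀ h₀ k hk =>
    obtain ⟨rfl, rfl⟩ := hF.reach_unique hH hp h h₀ (hη.trans hyν)
      ((hF.prefix_split_of_reach hH hp h₀).trans ((List.prefix_append _ _).trans hη'ν))
    exact ⟨k, hk, List.prefix_or_prefix_of_prefix hyν hη'ν⟩

theorem succ_fusion_split (h : Reach H ψ σ p n η r) :
    succ (fusion H ψ σ p) (σ (ψ n r) η) = H (σ (ψ n r) η).length := by
  ext j
  refine ⟨fun hj => ?_, fun hj => ⟨_, _, _, .succ h hj, List.prefix_refl _⟩⟩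
  obtain ⟨k, hk, hc⟩ := hF.exists_comparable hH hp hj h
    ((hF.prefix_split_of_reach hH hp h).trans (List.prefix_append _ _))
  have : j = k := by
    rcases hc with hc | hc
    · simpa [List.prefix_append_right_inj] using hc
    · simpa [List.prefix_append_right_inj, eq_comm] using hc
  exact this ▸ hk

theorem isCond_fusion : IsCond H (fusion H ψ σ p) where
  nonempty := ⟨[], 0, [], p, .zero, List.prefix_refl _⟩
  prefix_closed := fun ν hν η h => mem_fusion_of_prefix hν h
  mem_H := fun x hx => (hF.isCond p hp).mem_H x (hF.fusion_subset hH hp hx)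
  succ_card := by
    intro x hx
    obtain ⟨n, η, r, h, hηx, t, ht⟩ := hF.exists_reach_between hH hp hx
    cases t with
    | nil =>
      obtain rfl : x = σ (ψ n r) η := by simpa using ht
      right
      rw [hF.succ_fusion_split hH hp h, Set.ncard_coe_finset]
    | cons k t =>
      left
      rw [Set.ncard_eq_one]
      refine ⟨k, Set.ext fun j => ⟨fun hj => ?_, ?_⟩⟩
      · obtain ⟨l, -, hc⟩ := hF.exists_comparable hH hp hj h
          (hηx.trans (List.prefix_append _ _))
        rw [← ht, List.append_assoc, List.prefix_append_right_inj,
          List.prefix_append_right_inj] at hc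
        simp only [List.cons_append, List.cons_prefix_cons] at hc
        rcases hc with hc | hc
        · exact hc.1
        · exact hc.1.symm
      · rintro rfl
        have hs : σ (ψ n r) η ∈ fusion H ψ σ p := by
          obtain ⟨l, hl⟩ : (H (σ (ψ n r) η).length).Nonempty :=
            Finset.card_pos.1 (by have := hH (σ (ψ n r) η).length; omega)
          exact ⟨_, _, _, .succ h hl, List.prefix_append _ _⟩
        refine mem_fusion_of_prefix hs ?_
        rw [← ht]
        simp [List.prefix_append_right_inj]
  exists_split := by
    intro x hx
    obtain ⟨n, η, r, h, hηx, hxν⟩ := hF.exists_reach_between hH hp hx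
    have hs := hF.succ_fusion_split hH hp h
    obtain ⟨l, hl⟩ : (H (σ (ψ n r) η).length).Nonempty :=
      Finset.card_pos.1 (by have := hH (σ (ψ n r) η).length; omega)
    exact ⟨_, ⟨_, _, _, .succ h hl, List.prefix_append _ _⟩, hxν,
      by rw [hs, Set.ncard_coe_finset]⟩

/-- The conditions attached to the scheme nodes below a given one form a strictly decreasing chain:
each of them omits all but one of the immediate successors of the splitting node kept before. -/
theorem exists_chain (h : Reach H ψ σ p n η r) :
    ∃ c : ℕ → Set (List ℕ), c n = r ∧ (∀ m ≤ n, c m ∈ C) ∧ ∀ m < n, c (m + 1) ⊂ ψ m (c m) := by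
  induction h with
  | zero => exact ⟨fun _ => p, rfl, fun _ _ => hp, fun m hm => absurd hm (Nat.not_lt_zero m)⟩
  | @succ n η r h k hk ih =>
    obtain ⟨c, hcn, hC, hc⟩ := ih
    have hr := (hF.reach_spec hH hp h).1
    refine ⟨Function.update c (n + 1) (PT.restrict (ψ n r) (σ (ψ n r) η ++ [k])), by simp,
      fun m hm => ?_, fun m hm => ?_⟩
    · rcases hm.lt_or_eq with hm | rfl
      · rw [Function.update_of_ne hm.ne]
        exact hC m (by omega)
      · rw [Function.update_self]
        exact (hF.reach_spec hH hp (.succ h hk)).1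
    · rw [Function.update_of_ne hm.ne]
      rcases (Nat.lt_succ_iff.1 hm).lt_or_eq with hm | rfl
      · rw [Function.update_of_ne (by omega)]
        exact hc m hm
      · rw [Function.update_self, hcn]
        refine ⟨restrict_subset, fun hsub => ?_⟩
        obtain ⟨j, hj, hjk⟩ := Finset.exists_mem_ne (hH (σ (ψ m r) η).length) k
        rw [← Finset.mem_coe, ← hF.succ_split _ (hF.shrink_mem m r hr) _
          (hF.mem_shrink_of_reach hH hp h)] at hj
        rcases (hsub hj).2 with h | h
        · exact hjk (by simpa [List.prefix_append_right_inj] using h)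
        · exact hjk (by simpa [List.prefix_append_right_inj, eq_comm] using h)

/-- A condition that is included in the fusion contains scheme nodes of every level. -/
theorem exists_reach_mem (hq : IsCond H q) (hqF : q ⊆ fusion H ψ σ p) (n : ℕ) :
    ∃ η ∈ q, ∃ r, Reach H ψ σ p n η r := by
  induction n with
  | zero => exact ⟨[], hq.nil_mem, p, .zero⟩
  | succ n ih =>
    obtain ⟨η, hη, r, h⟩ := ih
    obtain ⟨y, hy, hl⟩ := (hq.restrict hη).exists_long hH ((σ (ψ n r) η).length + 1)
    have hηy : η <+: y := hy.2.resolve_left fun h' => by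
      have := h'.length_le
      have := (hF.prefix_split_of_reach hH hp h).length_le
      omega
    obtain ⟨k, hk, hc⟩ := hF.exists_comparable hH hp (hqF hy.1) h hηy
    have hc : σ (ψ n r) η ++ [k] <+: y := by
      rcases hc with hc | hc
      · rw [hc.eq_of_length_le (by simpa using hl)]
      · exact hc
    exact ⟨_, hq.prefix_closed y hy.1 _ hc, _, .succ h hk⟩

end IsFusionData

/-- **Fusion lemma**. Let `C` be a collection of conditions that is closed under full subtrees at
nodes, and let `ψ n` shrink the elements of `C`. Below every `p ∈ C` there is a condition `q`
such that, for any prescribed `n`, densely many conditions below `q` are included in all terms of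
a strictly decreasing chain `ψ 0 (c 0)`, …, `ψ (n - 1) (c (n - 1))` with all `c m` in `C`. -/
theorem exists_fusion (hH : ∀ n, 2 ≤ (H n).card) (hC : ∀ r ∈ C, IsCond H r)
    (hrestrict : ∀ r ∈ C, ∀ η ∈ r, restrict r η ∈ C) (hmem : ∀ n, ∀ r ∈ C, ψ n r ∈ C)
    (hsubset : ∀ n, ∀ r ∈ C, ψ n r ⊆ r) (hp : p ∈ C) :
    ∃ q, IsCond H q ∧ q ⊆ p ∧ ∀ q', IsCond H q' → q' ⊆ q → ∀ n, ∃ s, IsCond H s ∧ s ⊆ q' ∧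
      ∃ c : ℕ → Set (List ℕ), (∀ m < n, c m ∈ C ∧ s ⊆ ψ m (c m)) ∧
        ∀ m < n, ∀ l < m, ψ m (c m) ⊂ ψ l (c l) := by
  have hsplit : ∀ (r : Set (List ℕ)) (η : List ℕ), ∃ ν, r ∈ C → η ∈ r →
      η <+: ν ∧ succ r ν = H ν.length := by
    intro r η
    by_cases h : r ∈ C ∧ η ∈ r
    · obtain ⟨ν, -, hην, hs⟩ := (hC r h.1).exists_split η h.2
      exact ⟨ν, fun _ _ => ⟨hην, (hC r h.1).succ_eq_of_splits hs⟩⟩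
    · exact ⟨[], fun h₁ h₂ => absurd ⟨h₁, h₂⟩ h⟩
  choose σ hσ using hsplit
  have hF : IsFusionData H C ψ σ := ⟨hC, hrestrict, hmem, hsubset,
    fun r hr η hη => (hσ r η hr hη).1, fun r hr η hη => (hσ r η hr hη).2⟩
  refine ⟨fusion H ψ σ p, hF.isCond_fusion hH hp, hF.fusion_subset hH hp,
    fun q' hq' hsub n => ?_⟩
  obtain ⟨η, hη, r, h⟩ := hF.exists_reach_mem hH hp hq' hsub n
  obtain ⟨c, rfl, hcC, hc⟩ := hF.exists_chain hH hp h
  have hlt : ∀ m ≤ n, ∀ l < m, c m ⊂ ψ l (c l) := by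
    intro m
    induction m with
    | zero => exact fun _ l hl => absurd hl (Nat.not_lt_zero l)
    | succ m ih =>
      intro hm l hl
      rcases (Nat.lt_succ_iff.1 hl).lt_or_eq with hl | rfl
      · exact (hc m hm).trans_subset ((hsubset m _ (hcC m (by omega))).trans
          (ih (by omega) l hl).subset)
      · exact hc l hm
  suffices hs : restrict q' η ⊆ c n from
    ⟨restrict q' η, hq'.restrict hη, restrict_subset, c,
      fun m hm => ⟨hcC m hm.le, hs.trans (hlt n le_rfl m hm).subset⟩,
      fun m hm l hl => (hsubset m _ (hcC m hm.le)).trans_ssubset (hlt m hm.le l hl)⟩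
  rintro x ⟨hx, hxη | hηx⟩
  · exact (hC _ (hcC n le_rfl)).prefix_closed η (hF.mem_of_reach hH hp h) x hxη
  · exact hF.mem_of_mem_fusion hH hp (hsub hx) h hηx

end Fusion
end PT

/-! ### Closure properties of elementary submodels of `H(θ)` -/

namespace HSet
variable {θ : Cardinal.{u}} {x y : ZFSet.{u}}

theorem mem_of_subset (hy : y ∈ HSet θ) (h : x ⊆ y) : x ∈ HSet θ := by
  obtain ⟨t, ht, hyt, hc⟩ := hy
  exact ⟨t, ht, fun _ hz => hyt (h hz), hc⟩

theorem mem_of_mem (hy : y ∈ HSet θ) (h : x ∈ y) : x ∈ HSet θ := by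
  obtain ⟨t, ht, hyt, hc⟩ := hy
  exact ⟨t, ht, ht.subset_of_mem (hyt h), hc⟩

theorem insert_mem (hθ : Cardinal.aleph0 ≤ θ) (hx : x ∈ HSet θ) (hy : y ∈ HSet θ) :
    insert x y ∈ HSet θ := by
  obtain ⟨s, hs, hxs, hcs⟩ := hx
  obtain ⟨t, ht, hyt, hct⟩ := hy
  refine ⟨insert x (s ∪ t), fun a ha b hb => ?_, fun a ha => ?_, ?_⟩
  · rw [ZFSet.mem_insert_iff] at ha ⊢
    rcases ha with rfl | ha
    · exact Or.inr (ZFSet.mem_union.2 (Or.inl (hxs hb)))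
    · exact Or.inr ((hs.union ht).subset_of_mem ha hb)
  · rw [ZFSet.mem_insert_iff] at ha ⊢
    exact ha.imp_right fun h => ZFSet.mem_union.2 (Or.inr (hyt h))
  · exact ZFSet.card_insert_le.trans_lt (Cardinal.add_lt_of_lt hθ
      (ZFSet.card_union_le.trans_lt (Cardinal.add_lt_of_lt hθ hcs hct))
      (Cardinal.one_lt_aleph0.trans_le hθ))

theorem empty_mem (hθ : Cardinal.aleph0 ≤ θ) : ∅ ∈ HSet θ :=
  ⟨∅, ZFSet.isTransitive_empty, fun _ h => h,
    by simpa using Cardinal.aleph0_pos.trans_le hθ⟩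

theorem forall_mem_imp_iff (hx : x ∈ HSet θ) : (∀ a ∈ HSet θ, a ∈ x → a ∈ y) ↔ x ⊆ y :=
  ⟨fun h a ha => h a (mem_of_mem hx ha) ha, fun h _ _ ha => h ha⟩

end HSet

namespace ElemSubmodel
open FirstOrder Language

variable {θ : Cardinal.{u}} (M : ElemSubmodel θ) {x y : ZFSet.{u}}

/-- The membership symbol of the language of set theory. -/
def memSymbol : memLanguage.Relations 2 := MemSymbol.mem

/-- The atomic formula `s ∈ t`. -/
def memFormula {α : Type*} {n : ℕ} (s t : memLanguage.Term (α ⊕ Fin n)) :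
    memLanguage.BoundedFormula α n :=
  memSymbol.boundedFormula₂ s t

@[simp]
theorem realize_memFormula {α : Type*} {n : ℕ} {s t : memLanguage.Term (α ⊕ Fin n)}
    {v : α → HSet θ} {xs : Fin n → HSet θ} :
    (memFormula s t).Realize v xs ↔
      ((s.realize (Sum.elim v xs) : HSet θ) : ZFSet) ∈
        ((t.realize (Sum.elim v xs) : HSet θ) : ZFSet) := by
  rw [memFormula, BoundedFormula.realize_rel₂]
  rfl

/-- If a formula with parameters in `M` is satisfied in `H(θ)`, it is satisfied by a member of
`M`. -/
theorem exists_mem_of_realize {α : Type} (φ : memLanguage.BoundedFormula α 1) (v : α → M)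
    {a : HSet θ} (ha : φ.Realize (fun i => (v i : HSet θ)) fun _ => a) :
    ∃ b : HSet θ, b.1 ∈ M.sets ∧ φ.Realize (fun i => (v i : HSet θ)) fun _ => b := by
  have hsnoc : ∀ {A : Type (u + 1)} (a : A),
      (Fin.snoc (default : Fin 0 → A) a : Fin 1 → A) = fun _ => a := by
    intro A a
    ext i
    obtain rfl : i = Fin.last 0 := Fin.eq_zero i
    exact Fin.snoc_last (α := fun _ => A) _ _
  have h : φ.ex.Realize (M.subtype ∘ v) (M.subtype ∘ (default : Fin 0 → M)) := by
    rw [BoundedFormula.realize_ex]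
    refine ⟨a, ?_⟩
    rw [Subsingleton.elim (M.subtype ∘ (default : Fin 0 → M)) default, hsnoc]
    exact ha
  rw [M.subtype.map_boundedFormula, BoundedFormula.realize_ex] at h
  obtain ⟨b, hb⟩ := h
  rw [← M.subtype.map_boundedFormula, hsnoc] at hb
  exact ⟨b, ⟨b.1.2, b.2⟩, hb⟩

variable {M}

theorem empty_mem_sets (hθ : Cardinal.aleph0 ≤ θ) : ∅ ∈ M.sets := by
  obtain ⟨b, hb, h⟩ := M.exists_mem_of_realize (α := Empty)
    (∀' ∼(memFormula (&1) (&0))) Empty.elim (a := ⟨∅, HSet.empty_mem hθ⟩)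
    (by simp [Fin.snoc])
  simp only [Nat.reduceAdd, Function.comp_apply, Fin.isValue, BoundedFormula.realize_all,
    BoundedFormula.realize_not, realize_memFormula] at h
  have : b.1 = ∅ := (ZFSet.eq_empty _).2 fun z hz => h ⟨z, HSet.mem_of_mem b.2 hz⟩ hz
  exact this ▸ hb

theorem insert_mem_sets (hθ : Cardinal.aleph0 ≤ θ) (hx : x ∈ M.sets) (hy : y ∈ M.sets) :
    insert x y ∈ M.sets := by
  obtain ⟨b, hb, h⟩ := M.exists_mem_of_realize (α := Fin 2)
    (∀' (memFormula (&1) (&0) ⇔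
      (Term.bdEqual (&1) (Term.var (Sum.inl 0)) ⊔ memFormula (&1) (Term.var (Sum.inl 1)))))
    ![⟨_, hx.2⟩, ⟨_, hy.2⟩] (a := ⟨insert x y, HSet.insert_mem hθ hx.1 hy.1⟩)
    (by simp [Fin.snoc, Subtype.ext_iff])
  have h : ∀ a ∈ HSet θ, a ∈ b.1 ↔ a = x ∨ a ∈ y := by
    simpa [Fin.snoc, Subtype.ext_iff] using h
  have : b.1 = insert x y := by
    ext z
    rw [ZFSet.mem_insert_iff]
    refine ⟨fun hz => (h z (HSet.mem_of_mem b.2 hz)).1 hz, fun hz => (h z ?_).2 hz⟩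
    rcases hz with rfl | hz
    · exact hx.1
    · exact HSet.mem_of_mem hy.1 hz
  exact this ▸ hb

theorem pair_mem_sets (hθ : Cardinal.aleph0 ≤ θ) (hx : x ∈ M.sets) (hy : y ∈ M.sets) :
    ZFSet.pair x y ∈ M.sets := by
  have hs : ∀ {z : ZFSet}, z ∈ M.sets → ({z} : ZFSet) ∈ M.sets := fun {z} hz => by
    rw [← insert_empty_eq]
    exact insert_mem_sets hθ hz (empty_mem_sets hθ)
  exact insert_mem_sets hθ (hs hx) (hs (insert_mem_sets hθ hx (hs hy)))

/-- If some element of `x ∈ M` is a subset of `y ∈ M`, then there is such an element in `M`. -/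
theorem exists_mem_sets_subset (hx : x ∈ M.sets) (hy : y ∈ M.sets) (h : ∃ z ∈ x, z ⊆ y) :
    ∃ z ∈ M.sets, z ∈ x ∧ z ⊆ y := by
  obtain ⟨z, hzx, hzy⟩ := h
  obtain ⟨b, hb, h⟩ := M.exists_mem_of_realize (α := Fin 2)
    (memFormula (&0) (Term.var (Sum.inl 0)) ⊓
      ∀' (memFormula (&1) (&0) ⟹ memFormula (&1) (Term.var (Sum.inl 1))))
    ![⟨_, hx.2⟩, ⟨_, hy.2⟩] (a := ⟨z, HSet.mem_of_mem hx.1 hzx⟩)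
    (by simpa [Fin.snoc] using ⟨hzx, fun a _ ha => hzy ha⟩)
  have h : b.1 ∈ x ∧ ∀ a ∈ HSet θ, a ∈ b.1 → a ∈ y := by simpa [Fin.snoc] using h
  exact ⟨b, hb, h.1, (HSet.forall_mem_imp_iff b.2).1 h.2⟩

theorem sep_comparable_mem_sets (hx : x ∈ M.sets) (hy : y ∈ M.sets) :
    x.sep (fun z => z ⊆ y ∨ y ⊆ z) ∈ M.sets := by
  obtain ⟨b, hb, h⟩ := M.exists_mem_of_realize (α := Fin 2)
    (∀' (memFormula (&1) (&0) ⇔ (memFormula (&1) (Term.var (Sum.inl 0)) ⊓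
      ((∀' (memFormula (&2) (&1) ⟹ memFormula (&2) (Term.var (Sum.inl 1)))) ⊔
        ∀' (memFormula (&2) (Term.var (Sum.inl 1)) ⟹ memFormula (&2) (&1))))))
    ![⟨_, hx.2⟩, ⟨_, hy.2⟩]
    (a := ⟨x.sep (fun z => z ⊆ y ∨ y ⊆ z),
      HSet.mem_of_subset hx.1 fun z hz => (ZFSet.mem_sep.1 hz).1⟩)
    (by
      suffices ∀ a ∈ HSet θ, a ∈ x → (a ⊆ y ∨ y ⊆ a ↔
          (∀ z ∈ HSet θ, z ∈ a → z ∈ y) ∨ ∀ z ∈ HSet θ, z ∈ y → z ∈ a) by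
        simpa [Fin.snoc] using this
      intro a ha _
      rw [HSet.forall_mem_imp_iff ha, HSet.forall_mem_imp_iff hy.1])
  have h : ∀ a ∈ HSet θ, a ∈ b.1 ↔ a ∈ x ∧
      ((∀ z ∈ HSet θ, z ∈ a → z ∈ y) ∨ ∀ z ∈ HSet θ, z ∈ y → z ∈ a) := by
    simpa [Fin.snoc] using h
  have : b.1 = x.sep (fun z => z ⊆ y ∨ y ⊆ z) := by
    ext a
    rw [ZFSet.mem_sep]
    refine ⟨fun ha => ?_, fun ha => ?_⟩
    · have hθ := HSet.mem_of_mem b.2 ha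
      rw [h a hθ, HSet.forall_mem_imp_iff hθ, HSet.forall_mem_imp_iff hy.1] at ha
      exact ha
    · have hθ := HSet.mem_of_mem hx.1 ha.1
      rw [h a hθ, HSet.forall_mem_imp_iff hθ, HSet.forall_mem_imp_iff hy.1]
      exact ha
  exact this ▸ hb

end ElemSubmodel

/-! ### Codes of finite sequences and of trees -/

namespace PT

theorem natCode_mem_of_lt {m n : ℕ} (h : m < n) : natCode.{u} m ∈ natCode.{u} n := by
  induction n with
  | zero => omega
  | succ n ih =>
    rw [natCode, ZFSet.mem_insert_iff]
    rcases (Nat.lt_succ_iff.1 h).lt_or_eq with h | rfl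
    · exact Or.inr (ih h)
    · exact Or.inl rfl

theorem natCode_injective : Function.Injective natCode.{u} := by
  intro m n h
  rcases lt_trichotomy m n with hlt | heq | hlt
  · exact absurd (h ▸ natCode_mem_of_lt hlt) (ZFSet.mem_irrefl _)
  · exact heq
  · exact absurd (h ▸ natCode_mem_of_lt hlt) (ZFSet.mem_irrefl _)

theorem mem_seqCode {η : List ℕ} {z : ZFSet.{u}} :
    z ∈ seqCode η ↔ ∃ (i : ℕ) (hi : i < η.length), ZFSet.pair (natCode i) (natCode η[i]) = z := by
  rw [seqCode, ZFSet.mem_range]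
  exact ⟨fun ⟨i, hi⟩ => ⟨i, i.2, hi⟩, fun ⟨i, hi, h⟩ => ⟨⟨i, hi⟩, h⟩⟩

/-- Initial segments of finite sequences are inclusions of their graphs. -/
theorem seqCode_subset_iff {η ν : List ℕ} : seqCode.{u} η ⊆ seqCode ν ↔ η <+: ν := by
  constructor
  · intro h
    have key : ∀ (i : ℕ) (hi : i < η.length), ∃ hi' : i < ν.length, ν[i] = η[i] := by
      intro i hi
      obtain ⟨j, hj, hij⟩ := mem_seqCode.1 (h (mem_seqCode.2 ⟨i, hi, rfl⟩))
      obtain ⟨h₁, h₂⟩ := ZFSet.pair_inj.1 hij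
      obtain rfl := natCode_injective h₁
      exact ⟨hj, natCode_injective h₂⟩
    rw [List.prefix_iff_getElem]
    refine ⟨?_, fun i hi => (key i hi).2.symm⟩
    by_contra! hlt
    exact lt_irrefl _ (key _ hlt).1
  · intro h z hz
    obtain ⟨i, hi, rfl⟩ := mem_seqCode.1 hz
    exact mem_seqCode.2 ⟨i, hi.trans_le h.length_le, by rw [h.getElem]⟩

theorem seqCode_injective : Function.Injective seqCode.{u} := fun _ _ h =>
  (seqCode_subset_iff.1 fun _ hz => h ▸ hz).eq_of_length_le
    (seqCode_subset_iff.1 fun _ hz => h ▸ hz).length_le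

theorem mem_treeCode {p : Set (List ℕ)} {z : ZFSet.{u}} :
    z ∈ treeCode p ↔ ∃ η ∈ p, seqCode η = z := by
  rw [treeCode, ZFSet.mem_range]
  exact ⟨fun ⟨i, hi⟩ => ⟨i, i.2, hi⟩, fun ⟨i, hi, h⟩ => ⟨⟨i, hi⟩, h⟩⟩

theorem treeCode_subset_iff {p q : Set (List ℕ)} : treeCode.{u} p ⊆ treeCode q ↔ p ⊆ q := by
  constructor
  · intro h η hη
    obtain ⟨ν, hν, e⟩ := mem_treeCode.1 (h (mem_treeCode.2 ⟨η, hη, rfl⟩))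
    exact seqCode_injective e ▸ hν
  · intro h z hz
    obtain ⟨η, hη, rfl⟩ := mem_treeCode.1 hz
    exact mem_treeCode.2 ⟨η, h hη, rfl⟩

theorem treeCode_restrict (p : Set (List ℕ)) (η : List ℕ) :
    treeCode.{u} (restrict p η) =
      (treeCode p).sep fun z => z ⊆ seqCode η ∨ seqCode η ⊆ z := by
  ext z
  simp only [ZFSet.mem_sep, mem_treeCode]
  constructor
  · rintro ⟨x, ⟨hx, h⟩, rfl⟩
    exact ⟨⟨x, hx, rfl⟩, by rwa [seqCode_subset_iff, seqCode_subset_iff]⟩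
  · rintro ⟨⟨x, hx, rfl⟩, h⟩
    rw [seqCode_subset_iff, seqCode_subset_iff] at h
    exact ⟨x, ⟨hx, h⟩, rfl⟩

section Submodel

variable {θ : Cardinal.{u}} {M : ElemSubmodel θ}

theorem natCode_mem_sets (hθ : Cardinal.aleph0 ≤ θ) (n : ℕ) : natCode n ∈ M.sets := by
  induction n with
  | zero => exact ElemSubmodel.empty_mem_sets hθ
  | succ n ih => exact ElemSubmodel.insert_mem_sets hθ ih ih

theorem seqCode_mem_sets (hθ : Cardinal.aleph0 ≤ θ) (η : List ℕ) : seqCode η ∈ M.sets := by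
  induction η using List.reverseRecOn with
  | nil =>
    have : seqCode.{u} [] = ∅ := (ZFSet.eq_empty _).2 fun z hz => by
      obtain ⟨i, hi, -⟩ := mem_seqCode.1 hz
      simp at hi
    exact this ▸ ElemSubmodel.empty_mem_sets hθ
  | append_singleton η k ih =>
    have : seqCode.{u} (η ++ [k]) =
        insert (ZFSet.pair (natCode η.length) (natCode k)) (seqCode η) := by
      ext z
      simp only [ZFSet.mem_insert_iff, mem_seqCode, List.length_append, List.length_singleton]
      constructor
      · rintro ⟨i, hi, rfl⟩
        rcases (Nat.lt_succ_iff.1 hi).lt_or_eq with hi | rfl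
        · exact Or.inr ⟨i, hi, by rw [List.getElem_append_left hi]⟩
        · exact Or.inl (by simp)
      · rintro (rfl | ⟨i, hi, rfl⟩)
        · exact ⟨η.length, by omega, by simp⟩
        · exact ⟨i, by omega, by rw [List.getElem_append_left hi]⟩
    rw [this]
    exact ElemSubmodel.insert_mem_sets hθ (ElemSubmodel.pair_mem_sets hθ
      (natCode_mem_sets hθ _) (natCode_mem_sets hθ _)) ih

theorem treeCode_restrict_mem_sets (hθ : Cardinal.aleph0 ≤ θ) {p : Set (List ℕ)}
    (hp : treeCode p ∈ M.sets) (η : List ℕ) : treeCode (restrict p η) ∈ M.sets := by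
  rw [treeCode_restrict]
  exact ElemSubmodel.sep_comparable_mem_sets hp (seqCode_mem_sets hθ η)

end Submodel

/-! ### Conditions as trees -/

variable {H : ℕ → Finset ℕ}

/-- The tree coded by a condition of `PT_H`. -/
def tree (c : (forcing.{u} H).Cond) : Set (List ℕ) := {η | seqCode η ∈ c.val}

/-- The condition that codes a given tree. -/
def ofTree (p : Set (List ℕ)) (hp : IsCond H p) : (forcing.{u} H).Cond :=
  ⟨treeCode p, ZFSet.mem_range.2 ⟨⟨p, hp⟩, rfl⟩⟩

theorem exists_ofTree (c : (forcing.{u} H).Cond) : ∃ p hp, ofTree p hp = c := by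
  obtain ⟨⟨p, hp⟩, h⟩ := ZFSet.mem_range.1 c.mem_carrier
  exact ⟨p, hp, ForcingPoset.Cond.ext h⟩

@[simp]
theorem tree_ofTree {p : Set (List ℕ)} (hp : IsCond H p) : tree (ofTree.{u} p hp) = p := by
  ext η
  exact mem_treeCode.trans ⟨fun ⟨ν, hν, e⟩ => seqCode_injective e ▸ hν, fun h => ⟨η, h, rfl⟩⟩

theorem isCond_tree (c : (forcing.{u} H).Cond) : IsCond H (tree c) := by
  obtain ⟨p, hp, rfl⟩ := exists_ofTree c
  rwa [tree_ofTree]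

theorem treeCode_tree (c : (forcing.{u} H).Cond) : treeCode (tree c) = c.val := by
  obtain ⟨p, hp, rfl⟩ := exists_ofTree c
  rw [tree_ofTree]
  rfl

theorem le_iff_val {c d : (forcing.{u} H).Cond} : c ≤ d ↔ c.val ⊆ d.val := by
  constructor
  · intro h
    obtain ⟨a, ha, b, hb, hab, h'⟩ := ZFSet.mem_pairSep.1
      (show ZFSet.pair c.val d.val ∈ ZFSet.pairSep (· ⊆ ·) (carrier H) (carrier H) from h)
    obtain ⟨h₁, h₂⟩ := ZFSet.pair_inj.1 hab
    rwa [h₁, h₂]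
  · exact fun h => ZFSet.mem_pairSep.2 ⟨_, c.mem_carrier, _, d.mem_carrier, rfl, h⟩

theorem le_iff_tree {c d : (forcing.{u} H).Cond} : c ≤ d ↔ tree c ⊆ tree d := by
  rw [le_iff_val, ← treeCode_tree c, ← treeCode_tree d, treeCode_subset_iff]

theorem memGeneric_of_le {a s : (forcing.{u} H).Cond} (h : s ≤ a) :
    ForcingPoset.Forces s (ForcingPoset.memGeneric a) := fun r hr => ⟨r, le_rfl, hr.trans h⟩

/-- A dense set in `M` has an element in `M` below every condition in `M`. -/
theorem exists_condIn_le {θ : Cardinal.{u}} {M : ElemSubmodel θ} {D : ZFSet.{u}}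
    (hD : D ∈ M.sets) (hdense : (forcing H).IsDenseSubset D) (r : (forcing H).CondIn M) :
    ∃ d : (forcing H).CondIn M, d.1 ≤ r.1 ∧ d.1.val ∈ D := by
  obtain ⟨d, hdr, hd⟩ := hdense.2 r.1
  obtain ⟨z, hz, hzD, hzr⟩ :=
    ElemSubmodel.exists_mem_sets_subset hD r.2 ⟨d.val, hd, le_iff_val.1 hdr⟩
  exact ⟨⟨⟨z, hdense.1 hzD⟩, hz⟩, le_iff_val.2 hzr, hzD⟩

end PT

end

theorem lemma4p5 (H : ℕ → Finset ℕ) (hH : ∀ n, 2 ≤ (H n).card) :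
    (PT.forcing.{u} H).Dagger := by
  refine ⟨Cardinal.aleph0, fun θ hθ M hM _ p φ hφ => ?_⟩
  have hcount : M.sets.Countable := by
    refine (Set.countable_range fun x : M => (x.1 : ZFSet.{u})).mono ?_
    rintro x ⟨h, hx⟩
    exact ⟨⟨_, hx⟩, rfl⟩
  obtain ⟨f, hf⟩ := hcount.exists_eq_range ⟨_, p.2⟩
  have hfM : ∀ n, f n ∈ M.sets := fun n => hf ▸ Set.mem_range_self n
  have hd : ∀ (n : ℕ) (r : (PT.forcing H).CondIn M), ∃ d : (PT.forcing H).CondIn M,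
      d.1 ≤ r.1 ∧ ((PT.forcing H).IsDenseSubset (f n) → d.1.val ∈ f n) := by
    intro n r
    by_cases h : (PT.forcing H).IsDenseSubset (f n)
    · obtain ⟨d, hdr, hd⟩ := PT.exists_condIn_le (hfM n) h r
      exact ⟨d, hdr, fun _ => hd⟩
    · exact ⟨r, le_rfl, fun h' => absurd h' h⟩
  let C : Set (Set (List ℕ)) := {T | PT.IsCond H T ∧ PT.treeCode.{u} T ∈ M.sets}
  have htreeC : ∀ r : (PT.forcing H).CondIn M, PT.tree r.1 ∈ C := fun r =>
    ⟨PT.isCond_tree _, by rw [PT.treeCode_tree]; exact r.2⟩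
  -- In step `n`, enter the `n`-th set in `M` if it is dense, then apply `φ i` for the first
  -- component `i` of the pair coded by `n`, so that every `i` is treated infinitely often.
  have hψ : ∀ (n : ℕ) (T : Set (List ℕ)), ∃ T', T ∈ C → T' ⊆ T ∧
      ∃ d : (PT.forcing H).CondIn M, T' = PT.tree (φ n.unpair.1 d).1 ∧
        ((PT.forcing H).IsDenseSubset (f n) → d.1.val ∈ f n) := by
    intro n T
    by_cases hT : T ∈ C
    · obtain ⟨d, hdr, hd⟩ := hd n ⟨PT.ofTree T hT.1, hT.2⟩
      refine ⟨_, fun _ => ⟨?_, d, rfl, hd⟩⟩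
      have := PT.le_iff_tree.1 ((hφ n.unpair.1 d).trans hdr)
      rwa [PT.tree_ofTree] at this
    · exact ⟨T, fun h => absurd h hT⟩
  choose ψ hψ using hψ
  obtain ⟨q, hq, hqp, hchain⟩ := PT.exists_fusion (C := C) (ψ := ψ) hH (fun r hr => hr.1)
    (fun r hr η hη => ⟨hr.1.restrict hη, PT.treeCode_restrict_mem_sets hθ hr.2 η⟩)
    (fun n r hr => by
      obtain ⟨-, d, h, -⟩ := hψ n r hr
      exact h ▸ htreeC _)
    (fun n r hr => (hψ n r hr).1) (htreeC p)
  have hbelow : ∀ r ≤ PT.ofTree.{u} q hq, ∀ n, ∃ s ≤ r,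
      ∃ d : ℕ → (PT.forcing H).CondIn M,
        (∀ m < n, s ≤ (φ m.unpair.1 (d m)).1 ∧
          ((PT.forcing H).IsDenseSubset (f m) → (d m).1.val ∈ f m)) ∧
        ∀ m < n, ∀ l < m, (φ m.unpair.1 (d m)).1 ≠ (φ l.unpair.1 (d l)).1 := by
    intro r hr n
    obtain ⟨s, hs, hsr, c, hc, hlt⟩ := hchain (PT.tree r) (PT.isCond_tree r)
      (by simpa using PT.le_iff_tree.1 hr) n
    have hd : ∀ m, ∃ d : (PT.forcing H).CondIn M, m < n →
        ψ m (c m) = PT.tree (φ m.unpair.1 d).1 ∧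
          ((PT.forcing H).IsDenseSubset (f m) → d.1.val ∈ f m) := by
      intro m
      by_cases hm : m < n
      · obtain ⟨-, d, h⟩ := hψ m (c m) (hc m hm).1
        exact ⟨d, fun _ => h⟩
      · exact ⟨p, fun h => absurd h hm⟩
    choose d hd using hd
    refine ⟨PT.ofTree s hs, PT.le_iff_tree.2 (by simpa using hsr), d, fun m hm => ⟨?_, ?_⟩,
      fun m hm l hl h => ?_⟩
    · rw [PT.le_iff_tree, PT.tree_ofTree, ← (hd m hm).1]
      exact (hc m hm).2
    · exact (hd m hm).2
    · have := hlt m hm l hl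
      rw [(hd m hm).1, (hd l (hl.trans hm)).1, h] at this
      exact this.ne rfl
  refine ⟨PT.ofTree q hq, PT.le_iff_tree.2 (by simpa using hqp), ?_, ?_⟩
  · intro D hD hdense r hr
    obtain ⟨n, rfl⟩ : D ∈ Set.range f := hf ▸ hD
    obtain ⟨s, hsr, d, hs, -⟩ := hbelow r hr (n + 1)
    obtain ⟨hle, hmem⟩ := hs n n.lt_succ_self
    exact ⟨s, hsr, ⟨(d n).1, hmem hdense, (d n).2⟩,
      PT.memGeneric_of_le (hle.trans (hφ _ _))⟩
  · intro i n r hr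
    obtain ⟨s, hsr, d, hs, hne⟩ := hbelow r hr (Nat.pair i n)
    have hlt : ∀ k : Fin n, Nat.pair i k < Nat.pair i n := fun k => Nat.pair_lt_pair_right i k.2
    have hne' : ∀ k l : Fin n, l < k →
        (φ i (d (Nat.pair i k))).1 ≠ (φ i (d (Nat.pair i l))).1 := by
      intro k l hlk
      simpa using hne _ (hlt k) _ (Nat.pair_lt_pair_right i hlk)
    refine ⟨s, hsr, ⟨fun k => ⟨(φ i (d (Nat.pair i k))).1, _, rfl⟩, fun k l h => ?_⟩,
      fun k => PT.memGeneric_of_le ?_⟩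
    · have h := congrArg Subtype.val h
      rcases lt_trichotomy k l with hkl | hkl | hkl
      · exact absurd h.symm (hne' l k hkl)
      · exact hkl
      · exact absurd h (hne' k l hkl)
    · have := (hs _ (hlt k)).1
      rw [Nat.unpair_pair] at this
      exact this
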